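/- Let $\mathcal H$ be a real Hilbert space. A set-valued operator $A:\mathcal H\rightrightarrows\mathcal H$ is *monotone* if $\langle x-y,u-v\rangle\ge 0$ whenever $u\in A(x)$, $v\in A(y)$, and *maximally monotone* if moreover no monotone operator has a strictly larger graph. Its range is $\operatorname{ran}A=\bigcup_{z}A(z)$, its resolvent is $J_A=(\operatorname{Id}+A)^{-1}$, i.e. $J_A(x)=\{y: x\in y+A(y)\}$, and for $w\in\mathcal H$ its inner perturbation is $A_w(x)=A(x-w)$. **Theorem (Alternative parallel AAMR-like splitting algorithm).** Let $r\ge 1$, let $A_1,\dots,A_r:\mathcal H\rightrightarrows\mathcal H$ be maximally monotone, let $\gamma>0$, let $(\lambda_n)_{n\ge0}$ be a sequence in $[0,1]$ with $\sum_{n\ge0}\lambda_n(1-\lambda_n)=+\infty$, let $\beta\in(0,1)$, and let $q\in\operatorname{ran}\bigl(\operatorname{Id}+\frac{\gamma}{r(1-\beta)}\sum_{i=1}^rA_i\bigr)$. Given $x_{1,0},\dots,x_{r,0}\in\mathcal H$, set, for $n=0,1,2,\dots$ and $i=1,\dots,r$, $$p_n=\frac1r\sum_{i=1}^r x_{i,n},\qquad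 x_{i,n+1}=(1-\lambda_n)x_{i,n}+\lambda_n\bigl(2\beta J_{\gamma(A_i)_{-q}}-\operatorname{Id}\bigr)(2p_n-x_{i,n}).$$ Then these sequences are well defined (exactly one family of sequences with the given starting points satisfies the recursion), the set $J_{\frac{\gamma}{r(1-\beta)}\sum_{i=1}^rA_i}(q)$ consists of exactly one point (with which it is identified below), and: 1. for every $i$, $x_{i,n+1}-x_{i,n}\to0$ strongly as $n\to\infty$; 2. there are $x_1^\star,\dots,x_r^\star\in\mathcal H$ such that, for every $i$, $x_{i,n}$ converges weakly to $x_i^\star$, and $$q+\frac1{\beta r}\sum_{i=1}^r x_i^\star=J_{\frac{\gamma}{r(1-\beta)}\sum_{i=1}^rA_i}(q);$$ 3. $q+\frac1\beta p_n$ converges strongly to $J_{\frac{\gamma}{r(1-\beta)}\sum_{i=1}^rA_i}(q)$. -/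

import Mathlib

open Filter Topology
open scoped Pointwise

/-! A set-valued operator `A : H ⇉ H` is a function `A : H → Set H`. Sums, differences and real
multiples of operators are the pointwise ones: `(A + B) x = {a + b | a ∈ A x, b ∈ B x}` and
`(c • A) x = {c • a | a ∈ A x}`. -/

namespace SetOp

/-- The identity, as a set-valued operator. -/
def idOp {H : Type*} : H → Set H := fun x => {x}

/-- The range of a set-valued operator. -/
def ran {H : Type*} (A : H → Set H) : Set H := {u | ∃ z, u ∈ A z}

/-- Monotonicity: `⟪x - y, u - v⟫ ≥ 0` for all `(x, u)`, `(y, v)` in the graph. -/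
def IsMonotone {H : Type*} [NormedAddCommGroup H] [InnerProductSpace ℝ H] (A : H → Set H) : Prop :=
  ∀ x u, u ∈ A x → ∀ y v, v ∈ A y → 0 ≤ inner ℝ (x - y) (u - v)

/-- Maximal monotonicity: `A` is monotone and its graph contains each pair `(x, u)` that is
monotonically related to every point of the graph, so that no monotone operator has a strictly
larger graph. -/
def IsMaximallyMonotone {H : Type*} [NormedAddCommGroup H] [InnerProductSpace ℝ H]
    (A : H → Set H) : Prop :=
  IsMonotone A ∧ ∀ x u, (∀ y v, v ∈ A y → 0 ≤ inner ℝ (x - y) (u - v)) → u ∈ A x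

/-- The resolvent `J_A = (Id + A)⁻¹`, as a set-valued operator. -/
def resolvent {H : Type*} [AddCommGroup H] (A : H → Set H) : H → Set H :=
  fun x => {y | x ∈ (idOp + A : H → Set H) y}

/-- The inner `w`-perturbation `A_w(x) = A(x - w)`. -/
def innerPerturbation {H : Type*} [AddCommGroup H] (A : H → Set H) (w : H) : H → Set H :=
  fun x => A (x - w)

/-- The modified reflected resolvent `2 β J_A - Id`. -/
def modifiedReflectedResolvent {H : Type*} [AddCommGroup H] [Module ℝ H] (β : ℝ)
    (A : H → Set H) : H → Set H :=
  (2 * β) • resolvent A - idOp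

/-- The average `(1 / r) ∑ x_i`. -/
noncomputable def average {H : Type*} [AddCommGroup H] [Module ℝ H] {r : ℕ} (x : Fin r → H) : H :=
  (1 / (r : ℝ)) • ∑ i, x i

/-- `x n i` (that is, `x_{i,n}`) is generated by the alternative parallel AAMR-like scheme
`x_{i,n+1} = (1 - λ_n) x_{i,n} + λ_n (2 β J_{γ (A_i)_{-q}} - Id) (2 p_n - x_{i,n})`,
where `p_n` is the average of `x_{1,n}, …, x_{r,n}`. -/
def IsParallelIteration {H : Type*} [AddCommGroup H] [Module ℝ H] {r : ℕ}
    (A : Fin r → H → Set H) (γ β : ℝ) (lam : ℕ → ℝ) (q : H) (x : ℕ → Fin r → H) : Prop :=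
  ∀ n i, ∃ w ∈ modifiedReflectedResolvent β (γ • innerPerturbation (A i) (-q))
      ((2 : ℝ) • average (x n) - x n i),
    x (n + 1) i = (1 - lam n) • x n i + lam n • w

end SetOp

/-! By Minty's theorem each resolvent $J_i$ of $\gamma(A_i)_{-q}$ is single-valued on all of
$\mathcal H$, so the scheme determines its sequences. In the Hilbert sum $\mathcal H^r$ it is the
Krasnoselskii–Mann iteration of $T=(2\beta J-\mathrm{Id})\circ R$, where $J$ acts coordinatewise by
the $J_i$ and $R$ is reflection across the diagonal.

Since $R$ is an isometry and the $J_i$ are firmly nonexpansive,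
$\|TX-TY\|^2+4\beta(1-\beta)\|JRX-JRY\|^2\le\|X-Y\|^2$ (`norm_sq_aamrMap_sub_le`). At a fixed point
with average $p$ every $J_i$ returns $p/\beta$, and summing the resolvent inclusions puts
$q+p/\beta$ in the resolvent of the scaled sum at $q$. Conversely, a point of that resolvent, which
the range condition supplies, yields a fixed point of $T$. Hence the residual $TX_n-X_n$ vanishes
and $X_n$ converges weakly to a fixed point.

Strong convergence of the averages comes from the surplus term, positive because $0<\beta<1$: a
vanishing residual forces $JRX_n$ to converge in norm, and $p_n$ is recovered from one coordinate of
$JRX_n$ and of the residual. -/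

/-! ### Weak limits along ultrafilters -/

section WeakLimits

variable {H : Type*} [NormedAddCommGroup H] [InnerProductSpace ℝ H] [CompleteSpace H]

/-- Along an ultrafilter, a bounded family in a Hilbert space has a weak limit. -/
theorem Ultrafilter.exists_weak_limit {ι : Type*} (U : Ultrafilter ι) (f : ι → H) (C : ℝ)
    (hC : ∀ᶠ i in U, ‖f i‖ ≤ C) :
    ∃ y : H, ∀ v : H, Tendsto (fun i => inner ℝ (f i) v) U (𝓝 (inner ℝ y v)) := by
  have hbound : ∀ v : H, ∀ᶠ i in U, |inner ℝ (f i) v| ≤ C * ‖v‖ := fun v =>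
    hC.mono fun i hi => (abs_real_inner_le_norm _ _).trans
      (mul_le_mul_of_nonneg_right hi (norm_nonneg v))
  have hlim : ∀ v : H, ∃ l : ℝ, |l| ≤ C * ‖v‖ ∧
      Tendsto (fun i => inner ℝ (f i) v) U (𝓝 l) := by
    intro v
    obtain ⟨l, hl, hlU⟩ := (isCompact_Icc (a := -(C * ‖v‖)) (b := C * ‖v‖)).ultrafilter_le_nhds
      (U.map fun i => inner ℝ (f i) v)
      (le_principal_iff.2 ((hbound v).mono fun i hi => abs_le.1 hi))
    exact ⟨l, abs_le.2 hl, hlU⟩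
  choose l hlC hl using hlim
  let L : H →ₗ[ℝ] ℝ :=
    { toFun := l
      map_add' := fun v w => tendsto_nhds_unique (hl (v + w))
        (by simpa only [inner_add_right] using (hl v).add (hl w))
      map_smul' := fun c v => tendsto_nhds_unique (hl (c • v))
        (by simpa only [real_inner_smul_right, RingHom.id_apply, smul_eq_mul] using
          (hl v).const_mul c) }
  let L' : StrongDual ℝ H := L.mkContinuous C fun v => hlC v
  refine ⟨(InnerProductSpace.toDual ℝ H).symm L', fun v => ?_⟩
  rw [InnerProductSpace.toDual_symm_apply]
  exact hl v

theorem tendsto_toWeakSpace_of_inner {ι : Type*} {F : Filter ι} {f : ι → H} {y : H}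
    (h : ∀ v : H, Tendsto (fun i => inner ℝ (f i) v) F (𝓝 (inner ℝ y v))) :
    Tendsto (fun i => toWeakSpace ℝ H (f i)) F (𝓝 (toWeakSpace ℝ H y)) := by
  refine (WeakBilin.tendsto_iff_forall_eval_tendsto _ ?_).2 fun φ => ?_
  · intro a b hab
    refine ext_inner_left ℝ fun v => ?_
    exact LinearMap.congr_fun hab (innerSL ℝ v)
  · have key : ∀ z : H, φ z = inner ℝ z ((InnerProductSpace.toDual ℝ H).symm φ) := fun z => by
      rw [real_inner_comm, InnerProductSpace.toDual_symm_apply]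
    change Tendsto (fun i => φ (f i)) F (𝓝 (φ y))
    simpa only [key] using h _

end WeakLimits

/-! ### Minty's theorem -/

section Minty

variable {H : Type*} [NormedAddCommGroup H] [InnerProductSpace ℝ H]

/-- A finite monotone family `(a i, b i)` admits a point `y` with `⟪y - a i, y + b i⟫ ≤ 0`. -/
theorem exists_inner_sub_add_nonpos {ι : Type*} [Fintype ι] (a b : ι → H)
    (hmono : ∀ i j, 0 ≤ inner ℝ (a i - a j) (b i - b j)) :
    ∃ y : H, ∀ i, inner ℝ (y - a i) (y + b i) ≤ 0 := by
  classical
  rcases isEmpty_or_nonempty ι with hι | ⟨⟨i₀⟩⟩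
  · exact ⟨0, fun i => hι.elim i⟩
  -- Minimax duality: for fixed weights `μ`, the `μ`-average of `⟪y - a i, y + b i⟫` is minimal at
  -- `y = c μ / 2`, with value `-(‖c μ‖ ^ 2 / 4 + s μ)`. Optimal weights should therefore give the
  -- required `y`.
  let c : (ι → ℝ) → H := fun μ => ∑ i, μ i • (a i - b i)
  let s : (ι → ℝ) → ℝ := fun μ => ∑ i, μ i * inner ℝ (a i) (b i)
  have hcont : Continuous fun μ => ‖c μ‖ ^ 2 / 4 + s μ := by
    simp only [c, s]; fun_prop
  obtain ⟨μ, hμ, hmin⟩ := (isCompact_stdSimplex ℝ ι).exists_isMinOn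
    ⟨_, single_mem_stdSimplex ℝ i₀⟩ hcont.continuousOn
  -- Averaging monotonicity over pairs gives `s μ ≥ ⟪a', b'⟫`, and `‖a' - b'‖ ^ 2 / 4 + ⟪a', b'⟫ =
  -- ‖a' + b'‖ ^ 2 / 4`.
  have hval : 0 ≤ ‖c μ‖ ^ 2 / 4 + s μ := by
    set a' := ∑ i, μ i • a i with ha'
    set b' := ∑ i, μ i • b i with hb'
    have hc : c μ = a' - b' := by simp only [c, ha', hb', smul_sub, Finset.sum_sub_distrib]
    have h1 : 0 ≤ ∑ i, ∑ j, μ i * (μ j * inner ℝ (a i - a j) (b i - b j)) :=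
      Finset.sum_nonneg fun i _ => Finset.sum_nonneg fun j _ =>
        mul_nonneg (hμ.1 i) (mul_nonneg (hμ.1 j) (hmono i j))
    have h2 : ∑ i, ∑ j, μ i * (μ j * inner ℝ (a i - a j) (b i - b j))
        = 2 * s μ - 2 * inner ℝ a' b' := by
      have e1 : ∑ i, ∑ j, μ i * (μ j * inner ℝ (a i) (b i)) = s μ := by
        simp only [s]
        refine Finset.sum_congr rfl fun i _ => ?_
        rw [← Finset.mul_sum, ← Finset.sum_mul, hμ.2, one_mul]
      have e2 : ∑ i, ∑ j, μ i * (μ j * inner ℝ (a j) (b j)) = s μ := by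
        rw [← one_mul (s μ), ← hμ.2, Finset.sum_mul]
        refine Finset.sum_congr rfl fun i _ => ?_
        rw [← Finset.mul_sum]
      have e3 : ∑ i, ∑ j, μ i * (μ j * inner ℝ (a i) (b j)) = inner ℝ a' b' := by
        rw [Finset.sum_comm]
        simp only [ha', hb', sum_inner, inner_sum, real_inner_smul_left, real_inner_smul_right]
        refine Finset.sum_congr rfl fun i _ => Finset.sum_congr rfl fun j _ => ?_
        ring
      have e4 : ∑ i, ∑ j, μ i * (μ j * inner ℝ (a j) (b i)) = inner ℝ a' b' := by
        rw [Finset.sum_comm, ← e3]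
        refine Finset.sum_congr rfl fun i _ => Finset.sum_congr rfl fun j _ => ?_
        ring
      calc _ = ∑ i, ∑ j, (μ i * (μ j * inner ℝ (a i) (b i)) + μ i * (μ j * inner ℝ (a j) (b j))
            - μ i * (μ j * inner ℝ (a i) (b j)) - μ i * (μ j * inner ℝ (a j) (b i))) := by
            refine Finset.sum_congr rfl fun i _ => Finset.sum_congr rfl fun j _ => ?_
            rw [inner_sub_left, inner_sub_right, inner_sub_right]
            ring
        _ = _ := by
            simp only [Finset.sum_sub_distrib, Finset.sum_add_distrib, e1, e2, e3, e4]
            ring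
    have h3 : 0 ≤ ‖a' + b'‖ ^ 2 := sq_nonneg _
    rw [norm_add_sq_real] at h3
    rw [hc, norm_sub_sq_real]
    linarith
  refine ⟨(1 / 2 : ℝ) • c μ, fun i => ?_⟩
  set d := a i - b i - c μ with hd
  set k := inner ℝ (a i) (b i) - s μ with hk
  -- Minimality of `μ` along the segment towards vertex `i`; the linear coefficient is the
  -- directional derivative.
  have hquad : ∀ t ∈ Set.Icc (0 : ℝ) 1, 0 ≤ t * (inner ℝ (c μ) d / 2 + k) + t ^ 2 * (‖d‖ ^ 2 / 4) := by
    intro t ht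
    have hmem : (1 - t) • μ + t • Pi.single i 1 ∈ stdSimplex ℝ ι :=
      convex_stdSimplex ℝ ι hμ (single_mem_stdSimplex ℝ i) (by linarith [ht.2]) ht.1 (by ring)
    have h := hmin hmem
    have hc : c ((1 - t) • μ + t • Pi.single i 1) = c μ + t • d := by
      simp only [c, hd, Pi.add_apply, Pi.smul_apply, smul_eq_mul, add_smul, Finset.sum_add_distrib,
        Pi.single_apply, mul_ite, mul_one, mul_zero, ite_smul, zero_smul, Finset.sum_ite_eq',
        Finset.mem_univ, if_true, mul_smul, ← Finset.smul_sum]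
      module
    have hs : s ((1 - t) • μ + t • Pi.single i 1) = s μ + t * k := by
      simp only [s, hk, Pi.add_apply, Pi.smul_apply, smul_eq_mul, add_mul, Finset.sum_add_distrib,
        Pi.single_apply, mul_ite, mul_one, mul_zero, ite_mul, zero_mul, Finset.sum_ite_eq',
        Finset.mem_univ, if_true, mul_assoc, ← Finset.mul_sum]
      ring
    simp only [Set.mem_ofPred_eq, hc, hs, norm_add_sq_real, real_inner_smul_right, norm_smul,
      Real.norm_eq_abs, mul_pow, sq_abs] at h
    linarith
  have hlin : 0 ≤ inner ℝ (c μ) d / 2 + k := by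
    by_contra! hneg
    set m := inner ℝ (c μ) d / 2 + k
    set e := ‖d‖ ^ 2 / 4
    have he : 0 ≤ e := by positivity
    -- If the slope `m` were negative, this `t` in `(0, 1]` would give `m + t * e = -m ^ 2 / (e - m)
    -- < 0`.
    have ht : 0 < -m / (e - m) := div_pos (by linarith) (by linarith)
    have ht1 : -m / (e - m) ≤ 1 := (div_le_one (by linarith)).2 (by linarith)
    have h := hquad _ ⟨ht.le, ht1⟩
    have h' : 0 ≤ m + -m / (e - m) * e := by
      refine nonneg_of_mul_nonneg_right (a := -m / (e - m)) ?_ ht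
      linarith
    have h'' : m + -m / (e - m) * e = -m ^ 2 / (e - m) := by
      field_simp [show e - m ≠ 0 by linarith]
      ring
    rw [h''] at h'
    have : -m ^ 2 / (e - m) < 0 := div_neg_of_neg_of_pos (by nlinarith) (by linarith)
    linarith
  have hexp : inner ℝ ((1 / 2 : ℝ) • c μ - a i) ((1 / 2 : ℝ) • c μ + b i)
      = -(‖c μ‖ ^ 2 / 4 + s μ) - (inner ℝ (c μ) d / 2 + k) := by
    simp only [hd, hk, inner_sub_left, inner_sub_right, inner_add_right, real_inner_smul_left,
      real_inner_smul_right, real_inner_self_eq_norm_sq, real_inner_comm (c μ) (a i), norm_smul, mul_pow]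
    norm_num
    ring
  rw [hexp]
  linarith

variable [CompleteSpace H]

/-- Minty's theorem: `Id + A` is surjective when `A` is maximally monotone. -/
theorem SetOp.IsMaximallyMonotone.exists_sub_mem {A : H → Set H}
    (hA : SetOp.IsMaximallyMonotone A) (x : H) : ∃ y : H, x - y ∈ A y := by
  classical
  let G := {p : H × H // p.2 ∈ A p.1}
  have hfin : ∀ F : Finset G, ∃ y : H, ∀ p ∈ F, inner ℝ (y - p.1.1) (y + (p.1.2 - x)) ≤ 0 := by
    intro F
    obtain ⟨y, hy⟩ := exists_inner_sub_add_nonpos (fun p : F => p.1.1.1) (fun p : F => p.1.1.2 - x)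
      fun p p' => by
        rw [sub_sub_sub_cancel_right]
        exact hA.1 _ _ p.1.2 _ _ p'.1.2
    exact ⟨y, fun p hp => hy ⟨p, hp⟩⟩
  choose y hy using hfin
  -- Each graph point confines `u` to a closed ball; the family of balls has the finite intersection
  -- property, and a weak ultrafilter limit lies in all of them.
  have hball : ∀ p : G, ∀ u : H, inner ℝ (u - p.1.1) (u + (p.1.2 - x)) ≤ 0 ↔
      ‖u‖ ^ 2 ≤ inner ℝ u (p.1.1 - (p.1.2 - x)) + inner ℝ p.1.1 (p.1.2 - x) := by
    intro p u
    rw [inner_sub_left, inner_add_right, inner_add_right, inner_sub_right u p.1.1,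
      real_inner_self_eq_norm_sq, real_inner_comm u p.1.1]
    constructor <;> intro h <;> linarith
  rcases isEmpty_or_nonempty G with hG | ⟨⟨p₀⟩⟩
  -- With an empty graph, every pair is vacuously monotonically related to it.
  · exact ⟨0, hA.2 _ _ fun a b hb => hG.elim ⟨(a, b), hb⟩⟩
  let U : Ultrafilter (Finset G) := Ultrafilter.of atTop
  have hU : (U : Filter (Finset G)) ≤ atTop := Ultrafilter.of_le _
  have hev : ∀ p : G, ∀ᶠ F in (U : Filter (Finset G)), p ∈ F := fun p =>
    hU ((eventually_ge_atTop {p}).mono fun F hF => Finset.singleton_subset_iff.1 hF)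
  obtain ⟨z, hz⟩ := U.exists_weak_limit y
    (‖p₀.1.1 - (p₀.1.2 - x)‖ + |inner ℝ p₀.1.1 (p₀.1.2 - x)| + 1) <| by
      filter_upwards [hev p₀] with F hF
      have h := (hball p₀ _).1 (hy F p₀ hF)
      have h1 := real_inner_le_norm (y F) (p₀.1.1 - (p₀.1.2 - x))
      have h2 := le_abs_self (inner ℝ p₀.1.1 (p₀.1.2 - x))
      have h3 := norm_nonneg (p₀.1.1 - (p₀.1.2 - x))
      have h4 := norm_nonneg (y F)
      have h5 := abs_nonneg (inner ℝ p₀.1.1 (p₀.1.2 - x))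
      by_contra! hlt
      nlinarith
  refine ⟨z, hA.2 _ _ fun a b hb => ?_⟩
  let p : G := ⟨(a, b), hb⟩
  -- The norm is only weakly lower semicontinuous, so `‖y F‖ ^ 2` is replaced by its minorant `2 *
  -- ⟪y F, z⟫ - ‖z‖ ^ 2`, which is weakly continuous and exact at `z`.
  have hle : ∀ᶠ F in U, 2 * inner ℝ (y F) z - ‖z‖ ^ 2 ≤
      inner ℝ (y F) (a - (b - x)) + inner ℝ a (b - x) := by
    filter_upwards [hev p] with F hF
    have h := (hball p _).1 (hy F p hF)
    have h' : 0 ≤ ‖y F - z‖ ^ 2 := sq_nonneg _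
    rw [norm_sub_sq_real] at h'
    linarith
  have hlim := le_of_tendsto_of_tendsto (((hz z).const_mul 2).sub_const (‖z‖ ^ 2))
    ((hz (a - (b - x))).add_const (inner ℝ a (b - x))) hle
  rw [real_inner_self_eq_norm_sq] at hlim
  have := (hball p z).2 (by linarith)
  have e : x - z - b = -(z + (b - x)) := by abel
  rw [e, inner_neg_right]
  simpa [p] using this

end Minty

/-! ### The Krasnoselskii–Mann iteration -/

section KrasnoselskiiMann

variable {K : Type*} [NormedAddCommGroup K] [InnerProductSpace ℝ K]

theorem norm_sq_convex_combination (t : ℝ) (a b : K) :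
    ‖(1 - t) • a + t • b‖ ^ 2 =
      (1 - t) * ‖a‖ ^ 2 + t * ‖b‖ ^ 2 - t * (1 - t) * ‖b - a‖ ^ 2 := by
  simp only [norm_add_sq_real, norm_sub_sq_real, norm_smul, mul_pow, Real.norm_eq_abs, sq_abs,
    real_inner_smul_left, real_inner_smul_right, real_inner_comm a b]
  ring

/-- The Krasnoselskii–Mann sequence of `T` with relaxation parameters `lam`. -/
def IsMannIteration (T : K → K) (lam : ℕ → ℝ) (x : ℕ → K) : Prop :=
  ∀ n, x (n + 1) = (1 - lam n) • x n + lam n • T (x n)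

variable {T : K → K} {lam : ℕ → ℝ} {x : ℕ → K}

theorem IsMannIteration.succ_sub (hx : IsMannIteration T lam x) (n : ℕ) :
    x (n + 1) - x n = lam n • (T (x n) - x n) := by
  rw [hx n]; module

theorem IsMannIteration.norm_sq_add_le (hx : IsMannIteration T lam x)
    (hT : ∀ a b, ‖T a - T b‖ ≤ ‖a - b‖) (hlam : ∀ n, lam n ∈ Set.Icc (0 : ℝ) 1)
    {f : K} (hf : T f = f) (n : ℕ) :
    ‖x (n + 1) - f‖ ^ 2 + lam n * (1 - lam n) * ‖T (x n) - x n‖ ^ 2 ≤ ‖x n - f‖ ^ 2 := by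
  have e : x (n + 1) - f = (1 - lam n) • (x n - f) + lam n • (T (x n) - f) := by
    rw [hx n]; module
  have h : ‖T (x n) - f‖ ^ 2 ≤ ‖x n - f‖ ^ 2 := by
    have := hT (x n) f
    rw [hf] at this
    gcongr
  rw [e, norm_sq_convex_combination, sub_sub_sub_cancel_right]
  nlinarith [mul_le_mul_of_nonneg_left h (hlam n).1]

theorem IsMannIteration.antitone_norm_sub (hx : IsMannIteration T lam x)
    (hT : ∀ a b, ‖T a - T b‖ ≤ ‖a - b‖) (hlam : ∀ n, lam n ∈ Set.Icc (0 : ℝ) 1)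
    {f : K} (hf : T f = f) : Antitone fun n => ‖x n - f‖ := by
  refine antitone_nat_of_succ_le fun n => ?_
  have h := hx.norm_sq_add_le hT hlam hf n
  have h0 : 0 ≤ lam n * (1 - lam n) * ‖T (x n) - x n‖ ^ 2 :=
    mul_nonneg (mul_nonneg (hlam n).1 (sub_nonneg.2 (hlam n).2)) (sq_nonneg _)
  exact le_of_sq_le_sq (by linarith) (norm_nonneg _)

theorem IsMannIteration.antitone_residual (hx : IsMannIteration T lam x)
    (hT : ∀ a b, ‖T a - T b‖ ≤ ‖a - b‖) (hlam : ∀ n, lam n ∈ Set.Icc (0 : ℝ) 1) :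
    Antitone fun n => ‖T (x n) - x n‖ := by
  refine antitone_nat_of_succ_le fun n => ?_
  have e : T (x (n + 1)) - x (n + 1) =
      (T (x (n + 1)) - T (x n)) + (1 - lam n) • (T (x n) - x n) := by
    have hn := hx n
    generalize T (x (n + 1)) = y
    rw [hn]
    module
  calc ‖T (x (n + 1)) - x (n + 1)‖
      ≤ ‖x (n + 1) - x n‖ + ‖(1 - lam n) • (T (x n) - x n)‖ := by
        rw [e]; exact (norm_add_le _ _).trans (by gcongr; exact hT _ _)
    _ = ‖T (x n) - x n‖ := by
        rw [hx.succ_sub, norm_smul, norm_smul, Real.norm_of_nonneg (hlam n).1,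
          Real.norm_of_nonneg (sub_nonneg.2 (hlam n).2)]
        ring

/-- Divergence of the sum alone would only make the residuals small along a subsequence; their
monotonicity upgrades this. A positive limit `L` would bound the partial sums by `‖x 0 - f‖ ^ 2 / L
^ 2`. -/
theorem IsMannIteration.tendsto_residual (hx : IsMannIteration T lam x)
    (hT : ∀ a b, ‖T a - T b‖ ≤ ‖a - b‖) (hlam : ∀ n, lam n ∈ Set.Icc (0 : ℝ) 1)
    (hsum : Tendsto (fun N => ∑ n ∈ Finset.range N, lam n * (1 - lam n)) atTop atTop)
    {f : K} (hf : T f = f) : Tendsto (fun n => T (x n) - x n) atTop (𝓝 0) := by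
  rw [tendsto_zero_iff_norm_tendsto_zero]
  have hanti := hx.antitone_residual hT hlam
  have hL := tendsto_atTop_ciInf hanti ⟨0, by rintro _ ⟨n, rfl⟩; exact norm_nonneg _⟩
  set L := ⨅ n, ‖T (x n) - x n‖
  have hLle : ∀ n, L ≤ ‖T (x n) - x n‖ := fun n => hanti.le_of_tendsto hL n
  have hL0 : 0 ≤ L := ge_of_tendsto' hL fun n => norm_nonneg _
  rcases hL0.eq_or_lt with h0 | hpos
  · rwa [← h0] at hL
  exfalso
  have hbound : ∀ N, (∑ n ∈ Finset.range N, lam n * (1 - lam n)) * L ^ 2 + ‖x N - f‖ ^ 2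
      ≤ ‖x 0 - f‖ ^ 2 := by
    intro N
    induction N with
    | zero => simp
    | succ N ih =>
      have h := hx.norm_sq_add_le hT hlam hf N
      have h' : lam N * (1 - lam N) * L ^ 2 ≤ lam N * (1 - lam N) * ‖T (x N) - x N‖ ^ 2 :=
        mul_le_mul_of_nonneg_left (pow_le_pow_left₀ hL0 (hLle N) 2)
          (mul_nonneg (hlam N).1 (sub_nonneg.2 (hlam N).2))
      rw [Finset.sum_range_succ, add_mul]
      linarith
  obtain ⟨N, hN⟩ := (hsum.eventually_gt_atTop (‖x 0 - f‖ ^ 2 / L ^ 2)).exists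
  rw [div_lt_iff₀ (by positivity)] at hN
  linarith [hbound N, sq_nonneg ‖x N - f‖]

/-- The demiclosedness principle for nonexpansive maps. -/
theorem isFixedPt_of_weak_limit {ι : Type*} {F : Filter ι} [F.NeBot]
    (hT : ∀ a b, ‖T a - T b‖ ≤ ‖a - b‖) {y : ι → K} {u : K} {C : ℝ}
    (hC : ∀ i, ‖y i - u‖ ≤ C)
    (hy : ∀ v, Tendsto (fun i => inner ℝ (y i) v) F (𝓝 (inner ℝ u v)))
    (hres : Tendsto (fun i => T (y i) - y i) F (𝓝 0)) : T u = u := by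
  -- Expand `‖y i - T u‖ ^ 2` about `u` and compare with the nonexpansive bound; the cross term
  -- vanishes in the weak limit.
  have hle : ∀ i, ‖u - T u‖ ^ 2 ≤ ‖T (y i) - y i‖ ^ 2 + 2 * C * ‖T (y i) - y i‖
      - 2 * (inner ℝ (y i) (u - T u) - inner ℝ u (u - T u)) := by
    intro i
    have h1 : ‖y i - T u‖ ≤ ‖T (y i) - y i‖ + ‖y i - u‖ := by
      calc ‖y i - T u‖ = ‖-(T (y i) - y i) + (T (y i) - T u)‖ := by congr 1; abel
        _ ≤ _ := (norm_add_le _ _).trans (by rw [norm_neg]; gcongr; exact hT _ _)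
    have h2 := pow_le_pow_left₀ (norm_nonneg _) h1 2
    have h3 : ‖y i - T u‖ ^ 2 =
        ‖y i - u‖ ^ 2 + 2 * inner ℝ (y i - u) (u - T u) + ‖u - T u‖ ^ 2 := by
      rw [← norm_add_sq_real]; congr 2; abel
    rw [inner_sub_left] at h3
    nlinarith [mul_le_mul_of_nonneg_left (hC i) (norm_nonneg (T (y i) - y i))]
  have hlim : Tendsto (fun i => ‖T (y i) - y i‖ ^ 2 + 2 * C * ‖T (y i) - y i‖
      - 2 * (inner ℝ (y i) (u - T u) - inner ℝ u (u - T u))) F (𝓝 0) := by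
    have hn := tendsto_zero_iff_norm_tendsto_zero.1 hres
    have := ((hn.pow 2).add (hn.const_mul (2 * C))).sub
      (((hy (u - T u)).sub_const (inner ℝ u (u - T u))).const_mul 2)
    simpa using this
  have h0 : ‖u - T u‖ ^ 2 ≤ 0 := ge_of_tendsto' hlim hle
  have h1 : ‖u - T u‖ = 0 := by
    simpa using le_antisymm h0 (sq_nonneg _)
  exact (sub_eq_zero.1 (norm_eq_zero.1 h1)).symm

/-- Opial's argument: weak cluster points are fixed by demiclosedness, and distances to fixed points
converge. For two cluster points `u`, `w` this makes `⟪x n, w - u⟫` converge, so `⟪u, w - u⟫ = ⟪w, w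
- u⟫` and `u = w`. -/
theorem IsMannIteration.exists_weak_limit [CompleteSpace K] (hx : IsMannIteration T lam x)
    (hT : ∀ a b, ‖T a - T b‖ ≤ ‖a - b‖) (hlam : ∀ n, lam n ∈ Set.Icc (0 : ℝ) 1)
    (hsum : Tendsto (fun N => ∑ n ∈ Finset.range N, lam n * (1 - lam n)) atTop atTop)
    {f : K} (hf : T f = f) :
    ∃ u, T u = u ∧ ∀ v, Tendsto (fun n => inner ℝ (x n) v) atTop (𝓝 (inner ℝ u v)) := by
  have hres := hx.tendsto_residual hT hlam hsum hf
  have hbd : ∀ n, ‖x n - f‖ ≤ ‖x 0 - f‖ := fun n => hx.antitone_norm_sub hT hlam hf n.zero_le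
  have hcluster : ∀ U : Ultrafilter ℕ, (U : Filter ℕ) ≤ atTop → ∃ u, T u = u ∧
      ∀ v, Tendsto (fun n => inner ℝ (x n) v) U (𝓝 (inner ℝ u v)) := by
    intro U hU
    obtain ⟨u, hu⟩ := U.exists_weak_limit x (‖x 0 - f‖ + ‖f‖) (.of_forall fun n => by
      have := norm_add_le (x n - f) f
      rw [sub_add_cancel] at this
      linarith [hbd n])
    refine ⟨u, isFixedPt_of_weak_limit (C := ‖x 0 - f‖ + ‖f - u‖) hT (fun n => ?_) hu
      (hres.mono_left hU), hu⟩
    have := norm_add_le (x n - f) (f - u)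
    rw [sub_add_sub_cancel] at this
    linarith [hbd n]
  obtain ⟨u, hfix, hu⟩ := hcluster (Ultrafilter.of atTop) (Ultrafilter.of_le _)
  refine ⟨u, hfix, fun v => (tendsto_iff_ultrafilter _ _ _).2 fun U hU => ?_⟩
  obtain ⟨w, hwfix, hw⟩ := hcluster U hU
  have hconv : ∀ g, T g = g → ∃ l, Tendsto (fun n => ‖x n - g‖) atTop (𝓝 l) := fun g hg =>
    ⟨_, tendsto_atTop_ciInf (hx.antitone_norm_sub hT hlam hg)
      ⟨0, by rintro _ ⟨n, rfl⟩; exact norm_nonneg _⟩⟩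
  obtain ⟨l, hl⟩ := hconv u hfix
  obtain ⟨m, hm⟩ := hconv w hwfix
  have hinner : Tendsto (fun n => inner ℝ (x n) (w - u)) atTop
      (𝓝 ((l ^ 2 - m ^ 2 + (‖w‖ ^ 2 - ‖u‖ ^ 2)) / 2)) := by
    refine ((((hl.pow 2).sub (hm.pow 2)).add_const (‖w‖ ^ 2 - ‖u‖ ^ 2)).div_const 2).congr
      fun n => ?_
    rw [norm_sub_sq_real, norm_sub_sq_real, inner_sub_right]
    ring
  have h1 := tendsto_nhds_unique (hu (w - u)) (hinner.mono_left (Ultrafilter.of_le _))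
  have h2 := tendsto_nhds_unique (hw (w - u)) (hinner.mono_left hU)
  have h3 : inner ℝ (w - u) (w - u) = 0 := by rw [inner_sub_left, h1, h2, sub_self]
  have h4 : w = u := sub_eq_zero.1 (inner_self_eq_zero.1 h3)
  exact h4 ▸ hw v

end KrasnoselskiiMann

namespace SetOp

/-! ### Resolvents and inner perturbations -/

section Resolvents

variable {H : Type*} [NormedAddCommGroup H] [InnerProductSpace ℝ H]

theorem mem_resolvent_iff {H : Type*} [AddCommGroup H] {A : H → Set H} {x y : H} : y ∈ resolvent A x ↔ x - y ∈ A y := by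
  change x ∈ idOp y + A y ↔ _
  simp [idOp, sub_eq_neg_add]

theorem mem_smul_sum_iff {ι : Type*} [Fintype ι] {A : ι → H → Set H} {c : ℝ} {z u : H} :
    u ∈ (c • ∑ i, A i) z ↔ ∃ a : ι → H, (∀ i, a i ∈ A i z) ∧ c • ∑ i, a i = u := by
  rw [Pi.smul_apply, Finset.sum_apply, Set.mem_smul_set]
  simp only [Set.mem_fintype_sum]
  constructor
  · rintro ⟨_, ⟨a, ha, rfl⟩, h⟩
    exact ⟨a, ha, h⟩
  · rintro ⟨a, ha, h⟩
    exact ⟨_, ⟨a, ha, rfl⟩, h⟩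

theorem IsMonotone.smul_sum {ι : Type*} [Fintype ι] {A : ι → H → Set H}
    (hA : ∀ i, IsMonotone (A i)) {c : ℝ} (hc : 0 ≤ c) : IsMonotone (c • ∑ i, A i) := by
  intro x u hu y v hv
  obtain ⟨a, ha, rfl⟩ := mem_smul_sum_iff.1 hu
  obtain ⟨b, hb, rfl⟩ := mem_smul_sum_iff.1 hv
  rw [← smul_sub, ← Finset.sum_sub_distrib, real_inner_smul_right, inner_sum]
  exact mul_nonneg hc (Finset.sum_nonneg fun i _ => hA i _ _ (ha i) _ _ (hb i))

/-- The resolvent of a monotone operator is firmly nonexpansive. -/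
theorem IsMonotone.norm_sq_le_of_mem_resolvent {A : H → Set H} (hA : IsMonotone A)
    {x x' y y' : H} (hy : y ∈ resolvent A x) (hy' : y' ∈ resolvent A x') :
    ‖y - y'‖ ^ 2 ≤ inner ℝ (x - x') (y - y') := by
  have h := hA _ _ (mem_resolvent_iff.1 hy) _ _ (mem_resolvent_iff.1 hy')
  rw [sub_sub_sub_comm, inner_sub_right, real_inner_self_eq_norm_sq, real_inner_comm] at h
  linarith

theorem IsMonotone.resolvent_subsingleton {A : H → Set H} (hA : IsMonotone A) (x : H) :
    (resolvent A x).Subsingleton := by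
  intro y hy y' hy'
  have h := hA.norm_sq_le_of_mem_resolvent hy hy'
  rw [sub_self, inner_zero_left] at h
  exact sub_eq_zero.1 (norm_eq_zero.1 (by simpa using le_antisymm h (sq_nonneg _)))

theorem mem_smul_innerPerturbation_iff {A : H → Set H} {γ : ℝ} (hγ : γ ≠ 0) {w x u : H} :
    u ∈ (γ • innerPerturbation A w) x ↔ γ⁻¹ • u ∈ A (x - w) := by
  rw [Pi.smul_apply, Set.mem_smul_set_iff_inv_smul_mem₀ hγ, innerPerturbation]

theorem IsMaximallyMonotone.smul_innerPerturbation {A : H → Set H} (hA : IsMaximallyMonotone A)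
    {γ : ℝ} (hγ : 0 < γ) (w : H) : IsMaximallyMonotone (γ • innerPerturbation A w) := by
  constructor
  · intro x u hu y v hv
    rw [mem_smul_innerPerturbation_iff hγ.ne'] at hu hv
    have h := hA.1 _ _ hu _ _ hv
    rw [sub_sub_sub_cancel_right, ← smul_sub, real_inner_smul_right] at h
    exact nonneg_of_mul_nonneg_right h (inv_pos.2 hγ)
  · intro x u h
    rw [mem_smul_innerPerturbation_iff hγ.ne']
    refine hA.2 _ _ fun y v hv => ?_
    have h' := h (y + w) (γ • v) ((mem_smul_innerPerturbation_iff hγ.ne').2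
      (by rwa [inv_smul_smul₀ hγ.ne', add_sub_cancel_right]))
    have e : γ⁻¹ • u - v = γ⁻¹ • (u - γ • v) := by rw [smul_sub, inv_smul_smul₀ hγ.ne']
    rw [e, real_inner_smul_right, sub_sub, add_comm w y]
    exact mul_nonneg (inv_pos.2 hγ).le h'

theorem IsMaximallyMonotone.exists_resolvent_eq [CompleteSpace H] {A : H → Set H}
    (hA : IsMaximallyMonotone A) : ∃ J : H → H, ∀ x, resolvent A x = {J x} := by
  choose J hJ using hA.exists_sub_mem
  exact ⟨J, fun x => (hA.1.resolvent_subsingleton x).eq_singleton_of_mem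
    (mem_resolvent_iff.2 (hJ x))⟩

theorem modifiedReflectedResolvent_eq {A : H → Set H} {J : H → H}
    (hJ : ∀ x, resolvent A x = {J x}) (β : ℝ) (x : H) :
    modifiedReflectedResolvent β A x = {(2 * β) • J x - x} := by
  change (2 * β) • resolvent A x - idOp x = _
  rw [hJ, idOp, Set.smul_set_singleton, Set.singleton_sub_singleton]

end Resolvents

/-! ### The operator on the Hilbert sum and its fixed points -/

section AAMR

variable {H : Type*} [NormedAddCommGroup H] [InnerProductSpace ℝ H] {r : ℕ}

theorem average_sub (x y : Fin r → H) :
    average (fun i => x i - y i) = average x - average y := by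
  simp only [average, Finset.sum_sub_distrib, smul_sub]

theorem sum_eq_smul_average (hr : 0 < r) (x : Fin r → H) : ∑ i, x i = (r : ℝ) • average x := by
  have : (r : ℝ) ≠ 0 := by positivity
  rw [average, smul_smul, mul_one_div_cancel this, one_smul]

/-- Reflection across the diagonal is an isometry. -/
theorem sum_norm_sq_two_smul_average_sub (hr : 0 < r) (x : Fin r → H) :
    ∑ i, ‖(2 : ℝ) • average x - x i‖ ^ 2 = ∑ i, ‖x i‖ ^ 2 := by
  have h : ∑ i, inner ℝ (average x) (x i) = r * ‖average x‖ ^ 2 := by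
    rw [← inner_sum, sum_eq_smul_average hr, real_inner_smul_right, real_inner_self_eq_norm_sq]
  simp only [norm_sub_sq_real, norm_smul, mul_pow, real_inner_smul_left, Finset.sum_add_distrib,
    Finset.sum_sub_distrib, ← Finset.mul_sum, h]
  simp
  ring

/-- One unrelaxed step of the parallel scheme, with `J i` the resolvents, as a map of the Hilbert
sum. -/
noncomputable def aamrMap (J : Fin r → H → H) (β : ℝ) (X : PiLp 2 fun _ : Fin r => H) :
    PiLp 2 fun _ : Fin r => H :=
  WithLp.toLp 2 fun i => (2 * β) • J i ((2 : ℝ) • average X.ofLp - X i) -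
    ((2 : ℝ) • average X.ofLp - X i)

theorem norm_sq_modified_reflection_sub_le {β : ℝ} (hβ : 0 ≤ β) {a b u v : H}
    (h : ‖a - b‖ ^ 2 ≤ inner ℝ (u - v) (a - b)) :
    ‖((2 * β) • a - u) - ((2 * β) • b - v)‖ ^ 2 + 4 * β * (1 - β) * ‖a - b‖ ^ 2
      ≤ ‖u - v‖ ^ 2 := by
  have e : ((2 * β) • a - u) - ((2 * β) • b - v) = (2 * β) • (a - b) - (u - v) := by module
  rw [e, norm_sub_sq_real, norm_smul, mul_pow, Real.norm_eq_abs, sq_abs, real_inner_smul_left,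
    real_inner_comm]
  nlinarith [mul_le_mul_of_nonneg_left h hβ]

theorem norm_sq_aamrMap_sub_le (hr : 0 < r) {J : Fin r → H → H} {β : ℝ} (hβ : 0 ≤ β)
    (hJ : ∀ i u v, ‖J i u - J i v‖ ^ 2 ≤ inner ℝ (u - v) (J i u - J i v))
    (X Y : PiLp 2 fun _ : Fin r => H) :
    ‖aamrMap J β X - aamrMap J β Y‖ ^ 2 + 4 * β * (1 - β) *
      ∑ i, ‖J i ((2 : ℝ) • average X.ofLp - X i) - J i ((2 : ℝ) • average Y.ofLp - Y i)‖ ^ 2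
      ≤ ‖X - Y‖ ^ 2 := by
  have h := sum_norm_sq_two_smul_average_sub hr (fun i => X i - Y i)
  rw [PiLp.norm_sq_eq_of_L2, PiLp.norm_sq_eq_of_L2]
  simp only [PiLp.sub_apply]
  rw [← h, Finset.mul_sum, ← Finset.sum_add_distrib]
  refine Finset.sum_le_sum fun i _ => ?_
  have e : (2 : ℝ) • average (fun i => X i - Y i) - (X i - Y i) =
      ((2 : ℝ) • average X.ofLp - X i) - ((2 : ℝ) • average Y.ofLp - Y i) := by
    rw [average_sub]; module
  rw [e]
  exact norm_sq_modified_reflection_sub_le hβ (hJ i _ _)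

theorem isParallelIteration_iff {A : Fin r → H → Set H} {γ β : ℝ} {lam : ℕ → ℝ} {q : H}
    {J : Fin r → H → H}
    (hJ : ∀ i x, resolvent (γ • innerPerturbation (A i) (-q)) x = {J i x}) {x : ℕ → Fin r → H} :
    IsParallelIteration A γ β lam q x ↔
      IsMannIteration (aamrMap J β) lam fun n => WithLp.toLp 2 (x n) := by
  simp only [IsParallelIteration, IsMannIteration, modifiedReflectedResolvent_eq (hJ _),
    Set.mem_singleton_iff, exists_eq_left]
  refine forall_congr' fun n => ?_
  constructor
  · intro h
    ext i
    simpa [aamrMap] using h i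
  · intro h i
    simpa [aamrMap] using congrArg (fun X : PiLp 2 (fun _ : Fin r => H) => X i) h

/-- At a fixed point of `aamrMap`, all the resolvents take the same value. -/
theorem resolvent_eq_of_aamrMap_eq {J : Fin r → H → H} {β : ℝ} (hβ : β ≠ 0)
    {X : PiLp 2 fun _ : Fin r => H} (hX : aamrMap J β X = X) (i : Fin r) :
    J i ((2 : ℝ) • average X.ofLp - X i) = (1 / β) • average X.ofLp := by
  have h : (2 * β) • J i ((2 : ℝ) • average X.ofLp - X i) -
    ((2 : ℝ) • average X.ofLp - X i) = X i :=
      congrArg (fun Y : PiLp 2 (fun _ : Fin r => H) => Y i) hX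
  have h2 : (2 * β) • J i ((2 : ℝ) • average X.ofLp - X i) = (2 : ℝ) • average X.ofLp := by
    rw [sub_eq_iff_eq_add] at h
    rw [h]; abel
  have h3 := congrArg (fun y => (1 / (2 * β)) • y) h2
  simp only [smul_smul] at h3
  rw [one_div_mul_cancel (by simpa using hβ), one_smul] at h3
  rw [h3]
  congr 1
  field_simp

variable {A : Fin r → H → Set H} {γ β : ℝ} {q : H} {J : Fin r → H → H}

theorem mem_resolvent_of_aamrMap_eq (hr : 0 < r) (hγ : γ ≠ 0) (hβ : β ∈ Set.Ioo (0 : ℝ) 1)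
    (hJ : ∀ i x, resolvent (γ • innerPerturbation (A i) (-q)) x = {J i x})
    {X : PiLp 2 fun _ : Fin r => H} (hX : aamrMap J β X = X) :
    q + (1 / β) • average X.ofLp ∈ resolvent ((γ / (r * (1 - β))) • ∑ i, A i) q := by
  have hr' : (r : ℝ) ≠ 0 := by positivity
  have hβ0 : β ≠ 0 := hβ.1.ne'
  have hβ1 : 1 - β ≠ 0 := (sub_pos.2 hβ.2).ne'
  set p := average X.ofLp with hp
  rw [mem_resolvent_iff, mem_smul_sum_iff]
  -- These are the elements of `A i (q + p / β)` read off from the resolvent inclusions; as the `X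
  -- i` sum to `r p`, they sum to `-(r (1 - β) / (γ β)) p`.
  refine ⟨fun i => γ⁻¹ • ((2 : ℝ) • p - X i - (1 / β) • p), fun i => ?_, ?_⟩
  · have h : J i ((2 : ℝ) • p - X i) ∈
        resolvent (γ • innerPerturbation (A i) (-q)) ((2 : ℝ) • p - X i) := by
      rw [hJ]; exact Set.mem_singleton _
    rw [resolvent_eq_of_aamrMap_eq hβ0 hX i, mem_resolvent_iff,
      mem_smul_innerPerturbation_iff hγ, sub_neg_eq_add, add_comm _ q] at h
    exact h
  · have hs : ∑ i, X i = (r : ℝ) • p := sum_eq_smul_average hr X.ofLp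
    rw [← Finset.smul_sum, Finset.sum_sub_distrib, Finset.sum_sub_distrib, hs, Finset.sum_const,
      Finset.sum_const, Finset.card_univ, Fintype.card_fin, ← Nat.cast_smul_eq_nsmul ℝ,
      ← Nat.cast_smul_eq_nsmul ℝ]
    match_scalars <;> field_simp <;> ring

theorem exists_aamrMap_eq (hr : 0 < r) (hγ : γ ≠ 0) (hβ : β ∈ Set.Ioo (0 : ℝ) 1)
    (hJ : ∀ i x, resolvent (γ • innerPerturbation (A i) (-q)) x = {J i x}) {z : H}
    (hz : z ∈ resolvent ((γ / (r * (1 - β))) • ∑ i, A i) q) :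
    ∃ X : PiLp 2 fun _ : Fin r => H, aamrMap J β X = X := by
  have hr' : (r : ℝ) ≠ 0 := by positivity
  have hβ1 : 1 - β ≠ 0 := (sub_pos.2 hβ.2).ne'
  rw [mem_resolvent_iff, mem_smul_sum_iff] at hz
  obtain ⟨a, ha, hsum⟩ := hz
  have hsum' : ∑ i, a i = (r * (1 - β) / γ) • (q - z) := by
    rw [← hsum, smul_smul, div_mul_div_cancel₀ hγ, div_self (mul_ne_zero hr' hβ1), one_smul]
  -- Forced choice: every resolvent must return `z - q = p / β`, and `2 p - X i = (z - q) + γ a i`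
  -- then determines `X i`.
  let p := β • (z - q)
  let X : PiLp 2 fun _ : Fin r => H := WithLp.toLp 2 fun i => (2 : ℝ) • p - (z - q) - γ • a i
  have hp : average X.ofLp = p := by
    simp only [average, X, Finset.sum_sub_distrib, ← Finset.smul_sum, hsum', Finset.sum_const,
      Finset.card_univ, Fintype.card_fin, ← Nat.cast_smul_eq_nsmul ℝ, p]
    match_scalars <;> field_simp <;> ring
  refine ⟨X, ?_⟩
  ext i
  have hJi : J i ((2 : ℝ) • p - X i) = z - q := by
    have h : z - q ∈ resolvent (γ • innerPerturbation (A i) (-q)) ((2 : ℝ) • p - X i) := by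
      rw [mem_resolvent_iff, mem_smul_innerPerturbation_iff hγ, sub_neg_eq_add, sub_add_cancel]
      convert ha i using 1
      simp only [X]
      match_scalars <;> field_simp <;> ring
    rw [hJ] at h
    exact (Set.mem_singleton_iff.1 h).symm
  simp only [aamrMap, hp]
  rw [hJi]
  simp only [X, p]
  module

end AAMR

/-! ### Well-definedness and convergence of the averages -/

section Convergence

variable {H : Type*} [NormedAddCommGroup H] [InnerProductSpace ℝ H] {r : ℕ}
  {A : Fin r → H → Set H} {γ β : ℝ} {lam : ℕ → ℝ} {q : H} {J : Fin r → H → H}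

theorem existsUnique_isParallelIteration
    (hJ : ∀ i x, resolvent (γ • innerPerturbation (A i) (-q)) x = {J i x}) (x₀ : Fin r → H) :
    ∃! x : ℕ → Fin r → H, x 0 = x₀ ∧ IsParallelIteration A γ β lam q x := by
  let Y : ℕ → PiLp 2 fun _ : Fin r => H := fun n => Nat.rec (WithLp.toLp 2 x₀)
    (fun n X => (1 - lam n) • X + lam n • aamrMap J β X) n
  refine ⟨fun n => (Y n).ofLp, ⟨rfl, (isParallelIteration_iff hJ).2 fun n => rfl⟩, ?_⟩
  rintro x ⟨h0, hx⟩
  rw [isParallelIteration_iff hJ] at hx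
  have h : ∀ n, WithLp.toLp 2 (x n) = Y n := by
    intro n
    induction n with
    | zero => rw [h0]; rfl
    | succ n ih => exact (hx n).trans (by simp only [ih]; rfl)
  funext n
  rw [← h n]

theorem tendsto_average_of_isMannIteration (hr : 0 < r) (hβ : β ∈ Set.Ioo (0 : ℝ) 1)
    (hJ : ∀ i u v, ‖J i u - J i v‖ ^ 2 ≤ inner ℝ (u - v) (J i u - J i v))
    {X : ℕ → PiLp 2 fun _ : Fin r => H} {U : PiLp 2 fun _ : Fin r => H}
    (hU : aamrMap J β U = U) {C : ℝ} (hC : ∀ n, ‖X n - U‖ ≤ C)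
    (hres : Tendsto (fun n => aamrMap J β (X n) - X n) atTop (𝓝 0)) :
    Tendsto (fun n => average (X n).ofLp) atTop (𝓝 (average U.ofLp)) := by
  -- One coordinate suffices, since all resolvents share the same value at `U`.
  let i : Fin r := ⟨0, hr⟩
  have hβ' : 0 < 4 * β * (1 - β) := mul_pos (mul_pos four_pos hβ.1) (sub_pos.2 hβ.2)
  set y : ℕ → H := fun n => J i ((2 : ℝ) • average (X n).ofLp - X n i) with hy
  -- The surplus term is at most `‖X n - U‖ ^ 2 - ‖T (X n) - U‖ ^ 2` with `T = aamrMap J β`.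
  -- Factored, this is at most the residual norm times `2 * C`.
  have hle : ∀ n, ‖y n - (1 / β) • average U.ofLp‖ ^ 2 ≤
      ‖aamrMap J β (X n) - X n‖ * (2 * C) / (4 * β * (1 - β)) := by
    intro n
    have h := norm_sq_aamrMap_sub_le hr hβ.1.le hJ (X n) U
    have hs := Finset.single_le_sum (f := fun i => ‖J i ((2 : ℝ) • average (X n).ofLp - X n i) -
      J i ((2 : ℝ) • average U.ofLp - U i)‖ ^ 2) (fun i _ => sq_nonneg _) (Finset.mem_univ i)
    simp only [resolvent_eq_of_aamrMap_eq hβ.1.ne' hU] at hs h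
    rw [hU] at h
    have h1 : ‖X n - U‖ ≤ ‖aamrMap J β (X n) - U‖ + ‖aamrMap J β (X n) - X n‖ := by
      calc ‖X n - U‖ = ‖(aamrMap J β (X n) - U) - (aamrMap J β (X n) - X n)‖ := by
            rw [sub_sub_sub_cancel_left]
        _ ≤ _ := norm_sub_le _ _
    have h2 := mul_le_mul_of_nonneg_left hs hβ'.le
    rw [le_div_iff₀ hβ', mul_comm]
    have h3 := norm_nonneg (aamrMap J β (X n) - X n)
    have h4 := norm_nonneg (aamrMap J β (X n) - U)
    have h5 := hC n
    have h6 := norm_nonneg (X n - U)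
    have h7 : ‖aamrMap J β (X n) - U‖ ≤ ‖X n - U‖ := by
      refine le_of_sq_le_sq ?_ h6
      have := mul_nonneg hβ'.le ((sq_nonneg _).trans hs)
      linarith
    have h8 : ‖X n - U‖ ^ 2 - ‖aamrMap J β (X n) - U‖ ^ 2 ≤
        ‖aamrMap J β (X n) - X n‖ * (2 * C) := by
      have h9 : (‖X n - U‖ - ‖aamrMap J β (X n) - U‖) *
          (‖X n - U‖ + ‖aamrMap J β (X n) - U‖) ≤ ‖aamrMap J β (X n) - X n‖ * (2 * C) :=
        mul_le_mul (by linarith) (by linarith) (by linarith) h3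
      linarith
    exact h2.trans (by linarith)
  have hn := tendsto_zero_iff_norm_tendsto_zero.1 hres
  have hy_lim : Tendsto y atTop (𝓝 ((1 / β) • average U.ofLp)) := by
    rw [tendsto_iff_norm_sub_tendsto_zero]
    have h0 := squeeze_zero (fun n => sq_nonneg _) hle (by
      simpa using ((hn.mul_const (2 * C)).div_const (4 * β * (1 - β))))
    simpa using h0.sqrt
  have hres_i : Tendsto (fun n => (aamrMap J β (X n) - X n) i) atTop (𝓝 0) := by
    refine squeeze_zero_norm (fun n => ?_) hn
    exact PiLp.norm_apply_le _ i
  -- Coordinate `i` of the residual is `2 β y n - 2 p n`, hence `p n` equals `β y n` minus half of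
  -- it.
  have hlim := (hy_lim.const_smul β).sub (hres_i.const_smul (1 / 2 : ℝ))
  rw [smul_smul, mul_one_div_cancel hβ.1.ne', one_smul, smul_zero, sub_zero] at hlim
  refine hlim.congr fun n => ?_
  simp only [hy, aamrMap, PiLp.sub_apply]
  module

theorem tendsto_inner_apply {F : Filter ℕ} {X : ℕ → PiLp 2 fun _ : Fin r => H}
    {U : PiLp 2 fun _ : Fin r => H}
    (h : ∀ V, Tendsto (fun n => inner ℝ (X n) V) F (𝓝 (inner ℝ U V))) (i : Fin r) (v : H) :
    Tendsto (fun n => inner ℝ (X n i) v) F (𝓝 (inner ℝ (U i) v)) := by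
  have key : ∀ Y : PiLp 2 (fun _ : Fin r => H),
      inner ℝ Y (WithLp.toLp 2 (Pi.single i v)) = inner ℝ (Y i) v := by
    intro Y
    rw [PiLp.inner_apply, Finset.sum_eq_single i]
    · simp
    · intro j _ hj
      simp [hj]
    · simp
  simpa only [key] using h (WithLp.toLp 2 (Pi.single i v))

end Convergence

end SetOp

/-! ### The splitting theorem -/

theorem mainTheorem3 {H : Type*} [NormedAddCommGroup H] [InnerProductSpace ℝ H] [CompleteSpace H]
    (r : ℕ) (hr : 0 < r) (A : Fin r → H → Set H) (hA : ∀ i, SetOp.IsMaximallyMonotone (A i))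
    (γ : ℝ) (hγ : 0 < γ) (lam : ℕ → ℝ) (hlam : ∀ n, lam n ∈ Set.Icc (0 : ℝ) 1)
    (hsum : Tendsto (fun N => ∑ n ∈ Finset.range N, lam n * (1 - lam n)) atTop atTop)
    (β : ℝ) (hβ : β ∈ Set.Ioo (0 : ℝ) 1) (q : H)
    (hq : q ∈ SetOp.ran (SetOp.idOp + (γ / (r * (1 - β))) • ∑ i, A i))
    (x₀ : Fin r → H) :
    -- the scheme started at `x₀` is well defined
    (∃! x : ℕ → Fin r → H, x 0 = x₀ ∧ SetOp.IsParallelIteration A γ β lam q x) ∧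
    -- `z` is the value at `q` of the resolvent of `γ / (r (1 - β)) ∑ A_i`
    ∃ z : H, SetOp.resolvent ((γ / (r * (1 - β))) • ∑ i, A i) q = {z} ∧
      ∀ x : ℕ → Fin r → H, x 0 = x₀ → SetOp.IsParallelIteration A γ β lam q x →
        (∀ i, Tendsto (fun n => x (n + 1) i - x n i) atTop (𝓝 0)) ∧
        (∃ xs : Fin r → H,
          (∀ i, Tendsto (fun n => toWeakSpace ℝ H (x n i)) atTop (𝓝 (toWeakSpace ℝ H (xs i)))) ∧
          q + (1 / (β * r)) • ∑ i, xs i = z) ∧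
        Tendsto (fun n => q + (1 / β) • SetOp.average (x n)) atTop (𝓝 z) := by
  have hmax := fun i => (hA i).smul_innerPerturbation hγ (-q)
  choose J hJ using fun i => (hmax i).exists_resolvent_eq
  have hfirm : ∀ i u v, ‖J i u - J i v‖ ^ 2 ≤ inner ℝ (u - v) (J i u - J i v) := fun i u v =>
    (hmax i).1.norm_sq_le_of_mem_resolvent (by rw [hJ]; rfl) (by rw [hJ]; rfl)
  have hne : ∀ X Y, ‖SetOp.aamrMap J β X - SetOp.aamrMap J β Y‖ ≤ ‖X - Y‖ := by
    intro X Y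
    refine le_of_sq_le_sq ?_ (norm_nonneg _)
    refine le_trans (le_add_of_nonneg_right ?_) (SetOp.norm_sq_aamrMap_sub_le hr hβ.1.le hfirm X Y)
    exact mul_nonneg (mul_nonneg (mul_nonneg zero_le_four hβ.1.le) (sub_nonneg.2 hβ.2.le))
      (Finset.sum_nonneg fun i _ => sq_nonneg _)
  obtain ⟨z, hz⟩ := hq
  -- By definition, `q ∈ (Id + B) z` is the same as `z ∈ J_B q`.
  have hz : z ∈ SetOp.resolvent ((γ / (r * (1 - β))) • ∑ i, A i) q := hz
  have hc : 0 ≤ γ / (r * (1 - β)) :=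
    div_nonneg hγ.le (mul_nonneg r.cast_nonneg (sub_nonneg.2 hβ.2.le))
  have hsub := (SetOp.IsMonotone.smul_sum (fun i => (hA i).1) hc).resolvent_subsingleton q
  refine ⟨SetOp.existsUnique_isParallelIteration hJ x₀, z, hsub.eq_singleton_of_mem hz, ?_⟩
  intro x _ hx
  rw [SetOp.isParallelIteration_iff hJ] at hx
  obtain ⟨f, hf⟩ := SetOp.exists_aamrMap_eq hr hγ.ne' hβ hJ hz
  have hres := hx.tendsto_residual hne hlam hsum hf
  obtain ⟨U, hU, hweak⟩ := hx.exists_weak_limit hne hlam hsum hf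
  have hUz : q + (1 / β) • SetOp.average U.ofLp = z :=
    hsub (SetOp.mem_resolvent_of_aamrMap_eq hr hγ.ne' hβ hJ hU) hz
  refine ⟨fun i => ?_, ⟨U.ofLp, fun i => ?_, ?_⟩, ?_⟩
  · refine squeeze_zero_norm (fun n => ?_) (tendsto_zero_iff_norm_tendsto_zero.1 hres)
    have e : WithLp.toLp 2 (x (n + 1)) - WithLp.toLp 2 (x n) =
        lam n • (SetOp.aamrMap J β (WithLp.toLp 2 (x n)) - WithLp.toLp 2 (x n)) := hx.succ_sub n
    have h := PiLp.norm_apply_le (WithLp.toLp 2 (x (n + 1)) - WithLp.toLp 2 (x n)) i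
    rw [e, norm_smul, Real.norm_of_nonneg (hlam n).1, ← e] at h
    exact h.trans (mul_le_of_le_one_left (norm_nonneg _) (hlam n).2)
  · exact tendsto_toWeakSpace_of_inner (SetOp.tendsto_inner_apply hweak i)
  · rw [← hUz, SetOp.average, smul_smul, one_div_mul_one_div]
  · rw [← hUz]
    exact ((SetOp.tendsto_average_of_isMannIteration hr hβ hfirm hU
      (fun n => hx.antitone_norm_sub hne hlam hU n.zero_le) hres).const_smul (1 / β)).const_add q
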